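/- Let $\mathbb X$ be a Borel space (a topological space homeomorphic to a Borel subset of a Polish space) with Borel $\sigma$-algebra $\mathcal B(\mathbb X)$ and set of Borel probability measures $\mathcal P(\mathbb X)$ (with the weak topology), and let $\mathbb A$ be a countable set with the discrete topology. Consider a Markov decision process with state space $\mathbb X$ and action space $\mathbb A$: each state $x$ has a nonempty set $A(x)\subset\mathbb A$ of admissible actions, the graph $\Gamma=\{(x,a): x \in \mathbb X,\, a\in A(x)\}$ is Borel, the one-stage cost $c:\Gamma\to[0,+\infty]$ is Borel measurable (put $c=+\infty$ off $\Gamma$), and $q(dy\mid x,a)$ is a Borel measurable stochastic kernel on $\mathbb X$ given $\mathbb X\times\mathbb A$. A policy $\pi=(\mu_0,\mu_1,\dots)\in\Pi$ is a sequence of Borel measurable stochastic kernels $\mu_k(da_k\mid x_0,a_0,\dots,a_{k-1},x_k)$ on $\mathbb A$ with $\mu_k(A(x_k)\mid x_0,a_0,\dots,a_{k-1},x_k)=1$ for all histories; it is stationary if $\mu_k(da_k\mid x_0,\dots,x_k)=\mu(da_k\mid x_k)$ for all $k$ and one kernel $\mu$, and is then denoted by $\mu$. For $\pi\in\Pi$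 and $p\in\mathcal P(\mathbb X)$ let $$J(\pi,p)=\limsup_{n\to\infty}\frac1n\,\mathbb E^\pi_p\Big[\sum_{k=0}^{n-1}c(x_k,a_k)\Big],\qquad J(\pi,x)=J(\pi,\delta_x),$$ where $\mathbb{E}^\pi_p$ is the expectation for the process $(x_0,a_0,x_1,a_1,\dots)$ with initial distribution $x_0\sim p$, actions drawn by $\pi$ and transitions by $q$. Assume: (G) $J(\pi,x)<\infty$ for some $\pi\in\Pi$ and $x\in\mathbb X$. (SU) There are increasing sequences of compact sets $K_n\subset\mathbb X$ and $A_n\subset\mathbb A$ with $\lim_{n\to\infty}\inf_{(x,a)\notin K_n\times A_n}c(x,a)=+\infty$. (M) For each set $K\in\{K_n\}$ there are an open set $O\supset K$, a finite measure $\nu$ on $\mathcal B(\mathbb X)$ and a closed (possibly empty) set $D\subset\mathbb X$ such that, restricted to $D\times\mathbb A$, the kernel $q(dy\mid x,a)$ is (weakly) continuous and $c$ is lower semicontinuous, and $$q\big((O\setminus D)\cap B\mid x,a\big)\le\nu(B)\qquad\forall\,B\in\mathcal B(\mathbb X),\ (x,a)\in\Gamma.$$ Then there are a stationary policy $\bar\mu$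 and $\bar p\in\mathcal P(\mathbb X)$ such that $\bar p$ is an invariant probability measure of the Markov chain on $\mathbb X$ induced by $\bar\mu$, i.e. $\bar p(B)=\int\!\int q(B\mid x,a)\,\bar\mu(da\mid x)\,\bar p(dx)$ for all $B\in\mathcal B(\mathbb X)$, and $(\bar\mu,\bar p)$ is a minimum pair: $$J(\bar\mu,\bar p)=\inf_{p\in\mathcal P(\mathbb X)}\inf_{\pi\in\Pi}J(\pi,p).$$ -/

import Mathlib

open MeasureTheory ProbabilityTheory Filter Topology
open scoped ENNReal

universe u v

/-- A Borel space: a topological space homeomorphic to a Borel subset of a Polish space. -/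
def IsBorelSubsetOfPolish (X : Type u) [TopologicalSpace X] : Prop :=
  ∃ (Y : Type u) (_ : TopologicalSpace Y) (_ : PolishSpace Y) (e : X → Y),
    IsEmbedding e ∧ MeasurableSet[borel Y] (Set.range e)

/-- A Markov decision process with state space `X`, action space `𝔸`, Borel constraint graph
and nonnegative (possibly infinite) Borel one-stage cost. The cost is defined on the graph only. -/
structure MDP (X : Type u) (𝔸 : Type v) [MeasurableSpace X] [MeasurableSpace 𝔸] where
  /-- the set of admissible actions at each state -/
  A : X → Set 𝔸
  A_nonempty : ∀ x, (A x).Nonempty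
  measurableSet_graph : MeasurableSet {z : X × 𝔸 | z.2 ∈ A z.1}
  /-- the one-stage cost -/
  cost : {z : X × 𝔸 // z.2 ∈ A z.1} → ℝ≥0∞
  measurable_cost : Measurable cost
  /-- the state transition kernel `q(dy | x, a)` -/
  q : Kernel (X × 𝔸) X
  isMarkovKernel_q : IsMarkovKernel q

attribute [instance] MDP.isMarkovKernel_q

namespace MDP

variable {X : Type u} {𝔸 : Type v} [MeasurableSpace X] [MeasurableSpace 𝔸]

/-- The graph `Γ` of the control constraint. -/
def graph (M : MDP X 𝔸) : Set (X × 𝔸) := {z | z.2 ∈ M.A z.1}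

open Classical in
/-- The one-stage cost, extended by `+∞` to inadmissible state-action pairs. -/
noncomputable def c (M : MDP X 𝔸) (z : X × 𝔸) : ℝ≥0∞ :=
  if h : z.2 ∈ M.A z.1 then M.cost ⟨z, h⟩ else ⊤

/-- A Borel measurable (randomized, history-dependent) policy. The kernel of stage `k` takes the
past `(x₀, a₀, …, x_{k-1}, a_{k-1})` and the current state `x_k`. -/
structure Policy (M : MDP X 𝔸) where
  kernel : (k : ℕ) → Kernel ((Fin k → X × 𝔸) × X) 𝔸
  isMarkovKernel_kernel : ∀ k, IsMarkovKernel (kernel k)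
  admissible : ∀ k h x, kernel k (h, x) (M.A x) = 1

attribute [instance] Policy.isMarkovKernel_kernel

/-- A Borel measurable (randomized) stationary policy. -/
structure StationaryPolicy (M : MDP X 𝔸) where
  kernel : Kernel X 𝔸
  isMarkovKernel_kernel : IsMarkovKernel kernel
  admissible : ∀ x, kernel x (M.A x) = 1

attribute [instance] StationaryPolicy.isMarkovKernel_kernel

variable {M : MDP X 𝔸}

/-- The policy `(μ, μ, …)` that uses the stationary policy `μ` at every stage. -/
noncomputable def StationaryPolicy.toPolicy (μ : M.StationaryPolicy) : M.Policy where
  kernel _ := μ.kernel.comap Prod.snd measurable_snd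
  isMarkovKernel_kernel _ := inferInstance
  admissible _ _ x := μ.admissible x

/-- The transition kernel `x ↦ ∫ q(· | x, a) μ(da | x)` of the Markov chain on `X` induced by a
stationary policy `μ`. -/
noncomputable def StationaryPolicy.chain (μ : M.StationaryPolicy) : Kernel X X :=
  M.q ∘ₖ (Kernel.id ×ₖ μ.kernel)

namespace Policy

/-- The law of `(x₀, a₀)`, which is `p(dx₀) μ₀(da₀ | x₀)`. -/
noncomputable def initial (π : M.Policy) (p : Measure X) : Measure (X × 𝔸) :=
  p ⊗ₘ (π.kernel 0).comap (fun x => (Fin.elim0, x)) (by fun_prop)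

/-- The conditional law of `(x_{n+1}, a_{n+1})` given `(x₀, a₀, …, x_n, a_n)`, which is
`q(dx_{n+1} | x_n, a_n) μ_{n+1}(da_{n+1} | x₀, a₀, …, x_n, a_n, x_{n+1})`. -/
noncomputable def step (π : M.Policy) (n : ℕ) :
    Kernel ((i : Finset.Iic n) → X × 𝔸) (X × 𝔸) :=
  (M.q.comap (fun h : (i : Finset.Iic n) → X × 𝔸 => h ⟨n, Finset.mem_Iic.2 le_rfl⟩)
      (measurable_pi_apply _)) ⊗ₖ
    ((π.kernel (n + 1)).comap
      (fun z : ((i : Finset.Iic n) → X × 𝔸) × X =>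
        (fun i : Fin (n + 1) => z.1 ⟨i, Finset.mem_Iic.2 (Nat.lt_succ_iff.1 i.2)⟩, z.2))
      (by fun_prop))

instance (π : M.Policy) (n : ℕ) : IsMarkovKernel (π.step n) := by
  unfold step; infer_instance

/-- The law of the trajectory `(x₀, a₀, x₁, a₁, …)` under the policy `π` when `x₀ ∼ p`. -/
noncomputable def law (π : M.Policy) (p : Measure X) : Measure (ℕ → X × 𝔸) :=
  Kernel.trajMeasure (X := fun _ => X × 𝔸) (π.initial p) π.step

/-- The expected `n`-stage cost. Since `(x_k, a_k) ∈ Γ` almost surely, the values of the cost off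
`Γ` do not matter here. -/
noncomputable def Jn (π : M.Policy) (n : ℕ) (p : Measure X) : ℝ≥0∞ :=
  ∫⁻ ω, ∑ k ∈ Finset.range n, M.c (ω k) ∂(π.law p)

/-- The average cost of the policy `π` for the initial state distribution `p`. -/
noncomputable def J (π : M.Policy) (p : Measure X) : ℝ≥0∞ :=
  limsup (fun n : ℕ => π.Jn n p / n) atTop

end Policy

/-- `(π, p)` is a minimum pair: it attains the infimum of the average cost over all initial
distributions and all policies. -/
def IsMinimumPair (M : MDP X 𝔸) (π : M.Policy) (p : ProbabilityMeasure X) : Prop :=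
  π.J (p : Measure X) = ⨅ (p' : ProbabilityMeasure X) (π' : M.Policy), π'.J (p' : Measure X)

/-- Condition (G). -/
def CondG (M : MDP X 𝔸) : Prop :=
  ∃ (π : M.Policy) (x : X), π.J (Measure.dirac x) < ⊤

/-- Condition (SU) for the sequences `K`, `F` of sets of states and of actions. The infimum
over an empty set is `+∞`. -/
def CondSU [TopologicalSpace X] [TopologicalSpace 𝔸] (M : MDP X 𝔸)
    (K : ℕ → Set X) (F : ℕ → Set 𝔸) : Prop :=
  Monotone K ∧ Monotone F ∧ (∀ n, IsCompact (K n)) ∧ (∀ n, IsCompact (F n)) ∧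
    Tendsto (fun n => ⨅ z ∈ M.graph \ (K n ×ˢ F n), M.c z) atTop (𝓝 ⊤)

/-- The transition kernel as a map into the space of probability measures, which carries the
topology of weak convergence. -/
noncomputable def qProb (M : MDP X 𝔸) (z : X × 𝔸) : ProbabilityMeasure X :=
  ⟨M.q z, inferInstance⟩

/-- The majorization condition (M) for the sets `K n`. The lower semicontinuity clause says that
the epigraph of the cost restricted to `Γ ∩ (D × 𝔸)` is closed. -/
def CondM [TopologicalSpace X] [OpensMeasurableSpace X] [TopologicalSpace 𝔸] (M : MDP X 𝔸)
    (K : ℕ → Set X) : Prop :=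
  ∀ n, ∃ (O D : Set X) (ν : Measure X),
    IsOpen O ∧ K n ⊆ O ∧ IsFiniteMeasure ν ∧ IsClosed D ∧
    ContinuousOn M.qProb (D ×ˢ Set.univ) ∧
    LowerSemicontinuousOn M.c (D ×ˢ Set.univ) ∧
    ∀ B, MeasurableSet B → ∀ z ∈ M.graph, M.q z ((O \ D) ∩ B) ≤ ν B

end MDP

/-! Occupation measures of near-optimal policies are laws `γₙ` of state-action pairs whose costs are
at most the optimum plus a vanishing error. They are stationary up to `O(1/n)`, because the sums
over stages `1..n` and `0..n-1` differ only in their end terms. By (SU) and Markov's inequality they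
are tight, so Prokhorov's theorem gives a weak limit `γ` along a subsequence. If `γ` is exactly
stationary and costs at most the optimum, disintegrating it yields the stationary policy, and its
state marginal is the invariant law.

The difficulty is that neither the cost nor `z ↦ ∫ f dq(z)` need be semicontinuous, so weak
convergence alone says nothing about their integrals. Condition (M) repairs this: by approximate
stationarity the state marginals of the `γₙ` inherit the majorization of `q`, and the action set is
essentially finite. Hence on `K ×ˢ F` off `D ×ˢ univ` all `γₙ` are dominated, up to a vanishing
error, by one finite measure. A single Lusin set for that measure serves all `n`, which gives the
Fatou inequality `lintegral_le_liminf_of_majorizedOff`. Applied to the cost it gives optimality.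
Applied to `∫ f dq`, it gives one inequality between `q ∘ₘ γ` and `γ.fst`, which suffices for
equality of probability measures. -/

/-! ### Fatou's inequality for weak limits and discontinuous integrands -/

section LowerSemicontinuity

variable {Z : Type*} [TopologicalSpace Z]

/-- Closedness matters at a point of one set outside the other: there the filter of neighbourhoods
within the other set is trivial. -/
lemma LowerSemicontinuousOn.union_of_isClosed {g : Z → ℝ≥0∞} {D E : Set Z}
    (hD : IsClosed D) (hE : IsClosed E) (hgD : LowerSemicontinuousOn g D)
    (hgE : LowerSemicontinuousOn g E) : LowerSemicontinuousOn g (D ∪ E) := by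
  have key : ∀ {T : Set Z}, IsClosed T → LowerSemicontinuousOn g T → ∀ x, ∀ y < g x,
      ∀ᶠ x' in 𝓝[T] x, y < g x' := by
    intro T hT hg x y hy
    by_cases hx : x ∈ T
    · exact hg x hx y hy
    · rw [notMem_closure_iff_nhdsWithin_eq_bot.1 (by rwa [hT.closure_eq])]
      exact eventually_bot
  intro x _ y hy
  rw [nhdsWithin_union]
  exact eventually_sup.2 ⟨key hD hgD x y hy, key hE hgE x y hy⟩

lemma LowerSemicontinuousOn.piecewise_const_of_le {g : Z → ℝ≥0∞} {T : Set Z}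
    [∀ z, Decidable (z ∈ T)] {C : ℝ≥0∞}
    (hT : IsClosed T) (hg : LowerSemicontinuousOn g T) (hC : ∀ z, g z ≤ C) :
    LowerSemicontinuous (T.piecewise g fun _ => C) := by
  intro x y hy
  by_cases hx : x ∈ T
  · rw [Set.piecewise_eq_of_mem _ _ _ hx] at hy
    filter_upwards [eventually_nhdsWithin_iff.1 (hg x hx y hy)] with x' hx'
    by_cases h : x' ∈ T
    · rw [Set.piecewise_eq_of_mem _ _ _ h]; exact hx' h
    · rw [Set.piecewise_eq_of_notMem _ _ _ h]; exact hy.trans_le (hC x)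
  · rw [Set.piecewise_eq_of_notMem _ _ _ hx] at hy
    filter_upwards [hT.isOpen_compl.mem_nhds hx] with x' hx'
    rwa [Set.piecewise_eq_of_notMem _ _ _ hx']

variable [MeasurableSpace Z] [BorelSpace Z]

/-- A one-sided form of Lusin's theorem. -/
lemma exists_isClosed_subset_lowerSemicontinuousOn [TopologicalSpace.PseudoMetrizableSpace Z]
    (ν : Measure Z) [IsFiniteMeasure ν] {g : Z → ℝ≥0∞} (hg : Measurable g) {S : Set Z}
    (hS : MeasurableSet S) {ε : ℝ≥0∞} (hε : ε ≠ 0) :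
    ∃ E ⊆ S, IsClosed E ∧ LowerSemicontinuousOn g E ∧ ν (S \ E) ≤ ε := by
  have hε2 : ε / 2 ≠ 0 := (ENNReal.half_pos hε).ne'
  obtain ⟨δ, hδ, hδsum⟩ := ENNReal.exists_pos_sum_of_countable' hε2 ℕ
  let r : ℕ → ℝ≥0∞ := TopologicalSpace.denseSeq ℝ≥0∞
  -- Off the small open set `V n`, the sublevel set at `r n` agrees with the closed set `F n`.
  -- Removing all `V n` thus makes the sublevel sets at a dense set of levels relatively closed.
  have hV : ∀ n, ∃ F V : Set Z, IsClosed F ∧ F ⊆ {z | g z ≤ r n} ∧ IsOpen V ∧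
      {z | g z ≤ r n} \ F ⊆ V ∧ ν V ≤ δ n := by
    intro n
    obtain ⟨F, hFs, hF, hFn⟩ := (measurableSet_le hg measurable_const).exists_isClosed_sdiff_lt
      (μ := ν) (A := {z | g z ≤ r n}) (measure_ne_top _ _) (hδ n).ne'
    obtain ⟨V, hVs, hV, hVn⟩ := Set.exists_isOpen_lt_of_lt _ _ hFn
    exact ⟨F, V, hF, hFs, hV, hVs, hVn.le⟩
  choose F V hF hFs hVo hVs hVn using hV
  obtain ⟨E, hEs, hE, hEn⟩ := hS.exists_isClosed_sdiff_lt (μ := ν) (measure_ne_top _ _) hε2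
  refine ⟨E \ ⋃ n, V n, Set.sdiff_subset.trans hEs, ?_, ?_, ?_⟩
  · exact hE.sdiff (isOpen_iUnion hVo)
  · intro x hx y hy
    obtain ⟨t, ht, hyt⟩ := (TopologicalSpace.denseRange_denseSeq ℝ≥0∞).exists_between hy
    obtain ⟨n, rfl⟩ := ht
    have hxF : x ∉ F n := fun h => (hFs n h).not_gt hyt.2
    filter_upwards [nhdsWithin_le_nhds ((hF n).isOpen_compl.mem_nhds hxF), self_mem_nhdsWithin]
      with x' hx' hx'E
    by_contra hcon
    refine hx'E.2 (Set.mem_iUnion.2 ⟨n, hVs n ⟨?_, hx'⟩⟩)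
    exact (not_lt.1 hcon).trans hyt.1.le
  · calc ν (S \ (E \ ⋃ n, V n)) ≤ ν ((S \ E) ∪ ⋃ n, V n) := by
          apply measure_mono
          rw [Set.sdiff_sdiff_right]
          exact Set.union_subset_union_right _ Set.inter_subset_right
      _ ≤ ν (S \ E) + ∑' n, ν (V n) := (measure_union_le _ _).trans (by
          gcongr; exact measure_iUnion_le _)
      _ ≤ ε / 2 + ε / 2 := by
          gcongr
          exact (ENNReal.tsum_le_tsum hVn).trans hδsum.le
      _ = ε := ENNReal.add_halves ε

/-- Portmanteau theorem for bounded nonnegative lower semicontinuous functions. -/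
lemma LowerSemicontinuous.lintegral_le_liminf [HasOuterApproxClosed Z]
    {γ : ProbabilityMeasure Z} {γs : ℕ → ProbabilityMeasure Z} (hγ : Tendsto γs atTop (𝓝 γ))
    {h : Z → ℝ≥0∞} (hh : LowerSemicontinuous h) (hfin : ∀ z, h z ≠ ⊤) :
    ∫⁻ z, h z ∂(γ : Measure Z) ≤ liminf (fun n => ∫⁻ z, h z ∂(γs n : Measure Z)) atTop := by
  have hm : Measurable h := hh.measurable
  -- Layer cake: this reduces the claim to the portmanteau theorem for the open sets `{h > t}` and
  -- Fatou's lemma in `t`.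
  have key : ∀ m : Measure Z,
      ∫⁻ z, h z ∂m = ∫⁻ t in Set.Ioi (0 : ℝ), m {z | t < (h z).toReal} := by
    intro m
    rw [← lintegral_eq_lintegral_meas_lt m (Eventually.of_forall fun z => ENNReal.toReal_nonneg)
      hm.ennreal_toReal.aemeasurable]
    exact lintegral_congr fun z => (ENNReal.ofReal_toReal (hfin z)).symm
  simp_rw [key]
  refine le_trans ?_ (lintegral_liminf_le fun n => Antitone.measurable fun s t hst =>
    measure_mono fun z hz => lt_of_le_of_lt hst hz)
  refine setLIntegral_mono' measurableSet_Ioi fun t ht => ?_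
  refine ProbabilityMeasure.le_liminf_measure_open_of_tendsto hγ ?_
  have : {z | t < (h z).toReal} = h ⁻¹' Set.Ioi (ENNReal.ofReal t) := by
    ext z
    simp [ENNReal.ofReal_lt_iff_lt_toReal (le_of_lt ht) (hfin z)]
  rw [this]
  exact hh.isOpen_preimage _

/-- On `S`, off the closed set `D`, the measures `γs n` are majorized by the finite measure `ν` up
to an error that tends to `0`. -/
structure MajorizedOff (γs : ℕ → ProbabilityMeasure Z) (S D : Set Z) (ν : Measure Z)
    (δ : ℕ → ℝ≥0∞) : Prop where
  measurableSet : MeasurableSet S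
  isClosed : IsClosed D
  isFiniteMeasure : IsFiniteMeasure ν
  tendsto_zero : Tendsto δ atTop (𝓝 0)
  le : ∀ n B, MeasurableSet B → (γs n : Measure Z) (B ∩ (S \ D)) ≤ ν B + δ n

/-- Raising `g` to its bound `C` off `D ∪ E`, with `E` a Lusin set, makes it lower semicontinuous.
Since this only increases `g`, the limit `γ` needs no majorization; the price is paid on the `γs n`,
where `(D ∪ E)ᶜ` has small mass. -/
lemma lintegral_le_liminf_of_majorizedOff_of_le [TopologicalSpace.PseudoMetrizableSpace Z]
    {γ : ProbabilityMeasure Z} {γs : ℕ → ProbabilityMeasure Z} (hγ : Tendsto γs atTop (𝓝 γ))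
    {g : Z → ℝ≥0∞} (hg : Measurable g) {C : ℝ≥0∞} (hC : C ≠ ⊤) (hgC : ∀ z, g z ≤ C)
    (H : ∀ ε : ℝ≥0∞, ε ≠ 0 → ∃ S D ν δ, MajorizedOff γs S D ν δ ∧ LowerSemicontinuousOn g D ∧
      ∀ n, (γs n : Measure Z) Sᶜ ≤ ε) :
    ∫⁻ z, g z ∂(γ : Measure Z) ≤ liminf (fun n => ∫⁻ z, g z ∂(γs n : Measure Z)) atTop := by
  classical
  set a : ℕ → ℝ≥0∞ := fun n => ∫⁻ z, g z ∂(γs n : Measure Z)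
  have main : ∀ ε : ℝ≥0∞, ε ≠ 0 → ∫⁻ z, g z ∂(γ : Measure Z) ≤ liminf a atTop + C * (3 * ε) := by
    intro ε hε
    obtain ⟨S, D, ν, δ, hM, hgD, hS⟩ := H ε hε
    have := hM.isFiniteMeasure
    obtain ⟨E, hES, hE, hgE, hνE⟩ := exists_isClosed_subset_lowerSemicontinuousOn ν hg
      (hM.measurableSet.diff hM.isClosed.measurableSet) hε
    have hT : IsClosed (D ∪ E) := hM.isClosed.union hE
    have hlsc := (hgD.union_of_isClosed hM.isClosed hE hgE).piecewise_const_of_le hT hgC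
    set h : Z → ℝ≥0∞ := (D ∪ E).piecewise g fun _ => C
    have hgh : ∀ z, g z ≤ h z := fun z => by
      by_cases hz : z ∈ D ∪ E <;> simp [h, hz, hgC z]
    have hhC : ∀ z, h z ≤ C := fun z => by
      by_cases hz : z ∈ D ∪ E <;> simp [h, hz, hgC z]
    have hhg : ∀ z, h z ≤ g z + (D ∪ E)ᶜ.indicator (fun _ => C) z := fun z => by
      by_cases hz : z ∈ D ∪ E
      · simp [h, hz]
      · rw [Set.indicator_of_mem (Set.mem_compl hz)]
        exact (hhC z).trans le_add_self
    have hmass : ∀ n, (γs n : Measure Z) (D ∪ E)ᶜ ≤ ε + (ε + δ n) := by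
      intro n
      have hsub : (D ∪ E)ᶜ ⊆ Sᶜ ∪ (((S \ D) \ E) ∩ (S \ D)) := by
        intro z hz
        by_cases hzS : z ∈ S <;> simp_all
      refine (measure_mono hsub).trans ((measure_union_le _ _).trans ?_)
      gcongr
      · exact hS n
      · refine (hM.le n _ ?_).trans (by gcongr)
        exact (hM.measurableSet.diff hM.isClosed.measurableSet).diff hE.measurableSet
    calc ∫⁻ z, g z ∂(γ : Measure Z) ≤ ∫⁻ z, h z ∂(γ : Measure Z) := lintegral_mono hgh
      _ ≤ liminf (fun n => ∫⁻ z, h z ∂(γs n : Measure Z)) atTop :=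
          LowerSemicontinuous.lintegral_le_liminf hγ hlsc fun z => ((hhC z).trans_lt hC.lt_top).ne
      _ ≤ liminf (fun n => a n + C * (3 * ε)) atTop := by
          refine liminf_le_liminf ?_
          filter_upwards [hM.tendsto_zero.eventually_le_const hε.bot_lt] with n hn
          calc ∫⁻ z, h z ∂(γs n : Measure Z)
              ≤ ∫⁻ z, g z + (D ∪ E)ᶜ.indicator (fun _ => C) z ∂(γs n : Measure Z) :=
                lintegral_mono hhg
            _ = a n + C * (γs n : Measure Z) (D ∪ E)ᶜ := by
                rw [lintegral_add_left hg, lintegral_indicator_const hT.measurableSet.compl]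
            _ ≤ a n + C * (3 * ε) := by
                gcongr
                refine (hmass n).trans ?_
                calc ε + (ε + δ n) ≤ ε + (ε + ε) := by gcongr
                  _ = 3 * ε := by ring
      _ = liminf a atTop + C * (3 * ε) :=
          liminf_add_const _ _ _ (by isBoundedDefault) (by isBoundedDefault)
  have hlim : Tendsto (fun n : ℕ => liminf a atTop + C * (3 * (n : ℝ≥0∞)⁻¹)) atTop
      (𝓝 (liminf a atTop + C * (3 * 0))) :=
    tendsto_const_nhds.add (ENNReal.Tendsto.const_mul (ENNReal.Tendsto.const_mul
      ENNReal.tendsto_inv_nat_nhds_zero (Or.inr (by simp))) (Or.inr hC))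
  simpa using ge_of_tendsto' hlim fun n => main _ (by simp)

/-- The integral of `g` is lower semicontinuous along the weakly convergent sequence `γs` if, up to
sets of uniformly small mass, `g` is lower semicontinuous on a closed set off which the `γs n` are
asymptotically majorized by a finite measure. -/
lemma lintegral_le_liminf_of_majorizedOff [TopologicalSpace.PseudoMetrizableSpace Z]
    {γ : ProbabilityMeasure Z} {γs : ℕ → ProbabilityMeasure Z} (hγ : Tendsto γs atTop (𝓝 γ))
    {g : Z → ℝ≥0∞} (hg : Measurable g)
    (H : ∀ ε : ℝ≥0∞, ε ≠ 0 → ∃ S D ν δ, MajorizedOff γs S D ν δ ∧ LowerSemicontinuousOn g D ∧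
      ∀ n, (γs n : Measure Z) Sᶜ ≤ ε) :
    ∫⁻ z, g z ∂(γ : Measure Z) ≤ liminf (fun n => ∫⁻ z, g z ∂(γs n : Measure Z)) atTop := by
  have hsup : ∀ z, g z = ⨆ k : ℕ, min (g z) k := by
    intro z
    rw [← inf_iSup_eq, ENNReal.iSup_natCast, inf_top_eq]
  calc ∫⁻ z, g z ∂(γ : Measure Z) = ⨆ k : ℕ, ∫⁻ z, min (g z) k ∂(γ : Measure Z) := by
        rw [← lintegral_iSup (fun k => hg.min measurable_const)]
        · exact lintegral_congr hsup
        · intro i j hij z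
          exact min_le_min_left _ (by exact_mod_cast hij)
    _ ≤ _ := by
        refine iSup_le fun k => ?_
        refine (lintegral_le_liminf_of_majorizedOff_of_le hγ (hg.min measurable_const)
          (ENNReal.natCast_ne_top k) (fun z => min_le_right _ _) fun ε hε => ?_).trans ?_
        · obtain ⟨S, D, ν, δ, hM, hgD, hS⟩ := H ε hε
          refine ⟨S, D, ν, δ, hM, ?_, hS⟩
          exact hgD.inf lowerSemicontinuousOn_const
        · exact liminf_le_liminf (Eventually.of_forall fun n =>
            lintegral_mono fun z => min_le_left _ _)

end LowerSemicontinuity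

/-! ### Stage marginals and occupation measures -/

namespace MDP

variable {X : Type u} {𝔸 : Type v} [MeasurableSpace X] [MeasurableSpace 𝔸]

lemma measurable_c (M : MDP X 𝔸) : Measurable M.c := by
  classical
  unfold c
  exact Measurable.dite (s := {z : X × 𝔸 | z.2 ∈ M.A z.1}) M.measurable_cost measurable_const
    M.measurableSet_graph

lemma c_eq_top_of_notMem (M : MDP X 𝔸) {z : X × 𝔸} (hz : z ∉ M.graph) : M.c z = ⊤ :=
  dif_neg hz

lemma ae_mem_graph_of_lintegral_c_ne_top (M : MDP X 𝔸) {γ : Measure (X × 𝔸)}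
    (h : ∫⁻ z, M.c z ∂γ ≠ ⊤) : ∀ᵐ z ∂γ, z ∈ M.graph := by
  filter_upwards [ae_lt_top M.measurable_c h] with z hz
  by_contra hcon
  exact hz.ne (M.c_eq_top_of_notMem hcon)

variable {M : MDP X 𝔸}

namespace Policy

variable (π : M.Policy) (p : Measure X)

/-- The law of the state-action pair at stage `k`. -/
noncomputable def marginal (k : ℕ) : Measure (X × 𝔸) := (π.law p).map fun ω => ω k

/-- The expected empirical measure of the state-action pairs of the first `n` stages. -/
noncomputable def occupation (n : ℕ) : Measure (X × 𝔸) :=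
  (n : ℝ≥0∞)⁻¹ • ∑ k ∈ Finset.range n, π.marginal p k

lemma map_last_map_frestrictLe (k : ℕ) :
    ((π.law p).map (Preorder.frestrictLe k)).map
      (fun h : (i : Finset.Iic k) → X × 𝔸 => h ⟨k, Finset.mem_Iic.2 le_rfl⟩) = π.marginal p k := by
  rw [Measure.map_map (by fun_prop) (by fun_prop)]
  rfl

lemma Jn_eq_sum_marginal (n : ℕ) :
    π.Jn n p = ∑ k ∈ Finset.range n, ∫⁻ z, M.c z ∂(π.marginal p k) := by
  rw [Jn, lintegral_finsetSum _ fun k _ => by have := M.measurable_c; fun_prop]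
  refine Finset.sum_congr rfl fun k _ => ?_
  rw [marginal, lintegral_map M.measurable_c (measurable_pi_apply k)]

lemma lintegral_occupation (g : X × 𝔸 → ℝ≥0∞) (n : ℕ) :
    ∫⁻ z, g z ∂(π.occupation p n)
      = (n : ℝ≥0∞)⁻¹ * ∑ k ∈ Finset.range n, ∫⁻ z, g z ∂(π.marginal p k) := by
  rw [occupation, lintegral_smul_measure, lintegral_finsetSum_measure, smul_eq_mul]

lemma lintegral_c_occupation (n : ℕ) : ∫⁻ z, M.c z ∂(π.occupation p n) = π.Jn n p / n := by
  rw [lintegral_occupation, Jn_eq_sum_marginal, ENNReal.div_eq_inv_mul]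

lemma lintegral_fst_occupation {f : X → ℝ≥0∞} (hf : Measurable f) (n : ℕ) :
    ∫⁻ x, f x ∂(π.occupation p n).fst
      = (n : ℝ≥0∞)⁻¹ * ∑ k ∈ Finset.range n, ∫⁻ x, f x ∂(π.marginal p k).fst := by
  simp_rw [Measure.fst, lintegral_map hf measurable_fst]
  exact π.lintegral_occupation p (fun z => f z.1) n

lemma marginal_zero : π.marginal p 0 = π.initial p := by
  have h : (π.law p).map (Preorder.frestrictLe 0)
      = (π.initial p).map (MeasurableEquiv.piUnique (fun _ : Finset.Iic 0 => X × 𝔸)).symm := by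
    rw [law, Kernel.trajMeasure, Measure.map_comp _ _ (by fun_prop), Kernel.traj_map_frestrictLe,
      Kernel.partialTraj_self, Measure.id_comp]
  have h2 : π.marginal p 0 = ((π.law p).map (Preorder.frestrictLe 0)).map
      (MeasurableEquiv.piUnique (fun _ : Finset.Iic 0 => X × 𝔸)) := by
    rw [Measure.map_map (by fun_prop) (by fun_prop)]
    rfl
  rw [h2, h, MeasurableEquiv.map_map_symm]

variable [IsProbabilityMeasure p]

instance : IsProbabilityMeasure (π.initial p) := by
  unfold initial; infer_instance

instance : IsProbabilityMeasure (π.law p) := by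
  unfold law; infer_instance

instance (k : ℕ) : IsProbabilityMeasure (π.marginal p k) :=
  Measure.isProbabilityMeasure_map (measurable_pi_apply k).aemeasurable

lemma marginal_succ (k : ℕ) :
    π.marginal p (k + 1) = π.step k ∘ₘ (π.law p).map (Preorder.frestrictLe k) := by
  have h := Kernel.map_frestrictLe_trajMeasure_compProd_eq_map_trajMeasure
    (X := fun _ => X × 𝔸) (μ₀ := π.initial p) (κ := π.step) (a := k)
  rw [← Measure.snd_compProd]
  unfold law
  rw [h, Measure.snd, Measure.map_map (by fun_prop) (by fun_prop)]
  rfl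

/-- The state at stage `k + 1` has the law `∫ q(· | x, a) dγ_k`. -/
lemma fst_marginal_succ (k : ℕ) : (π.marginal p (k + 1)).fst = M.q ∘ₘ π.marginal p k := by
  ext B hB
  rw [marginal_succ, Measure.fst_apply hB, Measure.bind_apply (measurable_fst hB) (by fun_prop),
    ← map_last_map_frestrictLe, Measure.bind_apply hB (by fun_prop),
    lintegral_map (M.q.measurable_coe hB) (by fun_prop)]
  refine lintegral_congr fun h => ?_
  change π.step k h {z | z.1 ∈ B} = _
  rw [← Kernel.fst_apply' _ _ hB, step, Kernel.fst_compProd]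
  rfl

lemma isProbabilityMeasure_occupation {n : ℕ} (hn : n ≠ 0) :
    IsProbabilityMeasure (π.occupation p n) := by
  constructor
  simp [occupation, ENNReal.inv_mul_cancel, hn]

lemma lintegral_bind_occupation {f : X → ℝ≥0∞} (hf : Measurable f) (n : ℕ) :
    ∫⁻ x, f x ∂(M.q ∘ₘ π.occupation p n)
      = (n : ℝ≥0∞)⁻¹ * ∑ k ∈ Finset.range n, ∫⁻ x, f x ∂(π.marginal p (k + 1)).fst := by
  simp_rw [fst_marginal_succ, Measure.lintegral_bind M.q.aemeasurable hf.aemeasurable]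
  exact π.lintegral_occupation p _ n

lemma lintegral_fst_marginal_le {f : X → ℝ≥0∞} {C : ℝ≥0∞} (hC : ∀ x, f x ≤ C) (k : ℕ) :
    ∫⁻ x, f x ∂(π.marginal p k).fst ≤ C :=
  (lintegral_mono hC).trans (by simp)

lemma lintegral_bind_occupation_le {f : X → ℝ≥0∞} (hf : Measurable f) {C : ℝ≥0∞}
    (hC : ∀ x, f x ≤ C) (n : ℕ) :
    ∫⁻ x, f x ∂(M.q ∘ₘ π.occupation p n)
      ≤ ∫⁻ x, f x ∂(π.occupation p n).fst + (n : ℝ≥0∞)⁻¹ * C := by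
  rw [lintegral_bind_occupation _ _ hf, lintegral_fst_occupation _ _ hf, ← mul_add]
  gcongr
  -- Adjoin the stage `0` term, then split off the stage `n` term, which is at most `C`.
  refine le_self_add.trans ((Finset.sum_range_succ'
    (fun k => ∫⁻ x, f x ∂(π.marginal p k).fst) n).symm.trans_le ?_)
  rw [Finset.sum_range_succ]
  gcongr
  exact π.lintegral_fst_marginal_le p hC n

lemma lintegral_fst_occupation_le {f : X → ℝ≥0∞} (hf : Measurable f) {C : ℝ≥0∞}
    (hC : ∀ x, f x ≤ C) (n : ℕ) :
    ∫⁻ x, f x ∂(π.occupation p n).fst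
      ≤ ∫⁻ x, f x ∂(M.q ∘ₘ π.occupation p n) + (n : ℝ≥0∞)⁻¹ * C := by
  rw [lintegral_bind_occupation _ _ hf, lintegral_fst_occupation _ _ hf, ← mul_add]
  gcongr
  refine le_self_add.trans ((Finset.sum_range_succ _ n).symm.trans_le ?_)
  rw [Finset.sum_range_succ']
  gcongr
  exact π.lintegral_fst_marginal_le p hC 0

lemma fst_occupation_le (n : ℕ) {B : Set X} (hB : MeasurableSet B) :
    (π.occupation p n).fst B ≤ (M.q ∘ₘ π.occupation p n) B + (n : ℝ≥0∞)⁻¹ := by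
  have h := π.lintegral_fst_occupation_le p (f := B.indicator 1) (measurable_one.indicator hB)
    (C := 1) (fun x => Set.indicator_le_self' (by simp) x) n
  simpa [lintegral_indicator_one hB] using h

end Policy

/-! ### Stationary policies started from an invariant law -/

namespace StationaryPolicy

variable (μ : M.StationaryPolicy) {p : Measure X} [IsProbabilityMeasure p]

lemma bind_compProd_eq_chain : M.q ∘ₘ (p ⊗ₘ μ.kernel) = μ.chain ∘ₘ p := by
  rw [chain, ← Measure.comp_assoc, Measure.compProd_eq_comp_prod]

lemma marginal_toPolicy_of_invariant (h : Kernel.Invariant μ.chain p) (k : ℕ) :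
    μ.toPolicy.marginal p k = p ⊗ₘ μ.kernel := by
  induction k with
  | zero =>
    rw [Policy.marginal_zero]
    rfl
  | succ k ih =>
    have hfst : M.q ∘ₘ μ.toPolicy.marginal p k = p := by
      rw [ih, bind_compProd_eq_chain]
      exact h
    ext B hB
    rw [Policy.marginal_succ, Measure.bind_apply hB (by fun_prop)]
    conv_rhs => rw [← hfst]
    rw [Measure.compProd_apply hB, Measure.lintegral_bind M.q.aemeasurable
      (Kernel.measurable_kernel_prodMk_left hB).aemeasurable, ← Policy.map_last_map_frestrictLe,
      lintegral_map (Measurable.lintegral_kernel (Kernel.measurable_kernel_prodMk_left hB))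
        (by fun_prop)]
    refine lintegral_congr fun h => ?_
    rw [Policy.step, Kernel.compProd_apply hB]
    rfl

lemma J_toPolicy_of_invariant (h : Kernel.Invariant μ.chain p) :
    μ.toPolicy.J p = ∫⁻ z, M.c z ∂(p ⊗ₘ μ.kernel) := by
  rw [Policy.J]
  refine Tendsto.limsup_eq (tendsto_const_nhds.congr' ?_)
  filter_upwards [eventually_ne_atTop 0] with n hn
  simp_rw [Policy.Jn_eq_sum_marginal, μ.marginal_toPolicy_of_invariant h]
  rw [Finset.sum_const, Finset.card_range, nsmul_eq_mul, mul_comm,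
    ENNReal.mul_div_cancel_right (by exact_mod_cast hn) (by simp)]

end StationaryPolicy

end MDP

/-- Two probability measures coincide if the integrals of bounded continuous functions against them
compare. -/
lemma MeasureTheory.Measure.eq_of_forall_lintegral_le {X : Type*} [TopologicalSpace X]
    [MeasurableSpace X] [BorelSpace X] [HasOuterApproxClosed X] {α β : Measure X}
    [IsProbabilityMeasure α] [IsProbabilityMeasure β]
    (h : ∀ f : BoundedContinuousFunction X NNReal, ∫⁻ x, f x ∂α ≤ ∫⁻ x, f x ∂β) : α = β := by
  refine ext_of_forall_lintegral_eq_of_IsFiniteMeasure fun f => le_antisymm (h f) ?_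
  obtain ⟨C, hC⟩ : ∃ C : NNReal, ∀ x, f x ≤ C := ⟨nndist f 0, fun x => by
    simpa using BoundedContinuousFunction.NNReal.upper_bound f x⟩
  let g : BoundedContinuousFunction X NNReal := BoundedContinuousFunction.const X C - f
  have hg : ∀ m : Measure X, IsProbabilityMeasure m → ∫⁻ x, g x ∂m + ∫⁻ x, f x ∂m = C := by
    intro m hm
    rw [← lintegral_add_left g.continuous.measurable.coe_nnreal_ennreal]
    calc ∫⁻ x, (g x : ℝ≥0∞) + f x ∂m = ∫⁻ _, (C : ℝ≥0∞) ∂m := lintegral_congr fun x => by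
          rw [← ENNReal.coe_add]
          exact congrArg _ (tsub_add_cancel_of_le (hC x))
      _ = C := by simp
  -- The reverse inequality for `f` is the given one for `C - f`; cancelling needs a finite
  -- integral.
  have hfin : ∫⁻ x, g x ∂β ≠ ⊤ := fun htop => by simpa [htop] using hg β inferInstance
  refine (ENNReal.add_le_add_iff_left hfin).1 ?_
  rw [hg β inferInstance, ← hg α inferInstance]
  exact add_le_add_left (h g) _

/-! ### Near-optimal, approximately stationary laws -/

namespace MDP

variable {X : Type u} {𝔸 : Type v} [MeasurableSpace X] [MeasurableSpace 𝔸]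

/-- The infimum of the average cost over all initial distributions and all policies. -/
noncomputable def optimalCost (M : MDP X 𝔸) : ℝ≥0∞ :=
  ⨅ (p : ProbabilityMeasure X) (π : M.Policy), π.J (p : Measure X)

lemma optimalCost_le_J {M : MDP X 𝔸} (π : M.Policy) (p : ProbabilityMeasure X) :
    M.optimalCost ≤ π.J (p : Measure X) :=
  (iInf_le (fun p : ProbabilityMeasure X => ⨅ π : M.Policy, π.J (p : Measure X)) p).trans
    (iInf_le (fun π : M.Policy => π.J (p : Measure X)) π)

lemma optimalCost_lt_top {M : MDP X 𝔸} (hG : M.CondG) : M.optimalCost < ⊤ := by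
  obtain ⟨π, x, h⟩ := hG
  exact (optimalCost_le_J π ⟨Measure.dirac x, inferInstance⟩).trans_lt h

/-- `γ` is the joint law of a state-action pair that is stationary up to the error `δ`. -/
structure IsApproxStationary (M : MDP X 𝔸) (γ : Measure (X × 𝔸)) (δ : ℝ≥0∞) : Prop where
  lintegral_le : ∀ (f : X → ℝ≥0∞) (C : ℝ≥0∞), Measurable f → (∀ x, f x ≤ C) →
    ∫⁻ x, f x ∂(M.q ∘ₘ γ) ≤ ∫⁻ x, f x ∂γ.fst + δ * C
  fst_le : ∀ B, MeasurableSet B → γ.fst B ≤ (M.q ∘ₘ γ) B + δ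

lemma exists_isApproxStationary (M : MDP X 𝔸) (hM : M.optimalCost < ⊤) (n : ℕ) :
    ∃ γ : ProbabilityMeasure (X × 𝔸), M.IsApproxStationary γ ((n : ℝ≥0∞) + 1)⁻¹ ∧
      ∫⁻ z, M.c z ∂(γ : Measure (X × 𝔸)) ≤ M.optimalCost + ((n : ℝ≥0∞) + 1)⁻¹ := by
  have hlt : M.optimalCost < M.optimalCost + ((n : ℝ≥0∞) + 1)⁻¹ :=
    ENNReal.lt_add_right hM.ne (by simp)
  obtain ⟨p, hp⟩ := iInf_lt_iff.1 hlt
  obtain ⟨π, hπ⟩ := iInf_lt_iff.1 hp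
  -- A horizon `N ≥ n + 1` makes the occupation measure a probability and its end-term error at most
  -- `1/(n+1)`.
  obtain ⟨N, hN, hnN⟩ :=
    ((eventually_lt_of_limsup_lt hπ).and (eventually_ge_atTop (n + 1))).exists
  have hNn : (N : ℝ≥0∞)⁻¹ ≤ ((n : ℝ≥0∞) + 1)⁻¹ := ENNReal.inv_le_inv.2 (by exact_mod_cast hnN)
  refine ⟨⟨π.occupation p N, π.isProbabilityMeasure_occupation p (by lia)⟩, ⟨?_, ?_⟩, ?_⟩
  · intro f C hf hC
    exact (π.lintegral_bind_occupation_le p hf hC N).trans (by gcongr; rfl)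
  · intro B hB
    exact (π.fst_occupation_le p N hB).trans (by gcongr; rfl)
  · exact (π.lintegral_c_occupation p N).trans_le hN.le

/-! ### Tightness, majorization and passage to the limit -/

section Topology

variable [TopologicalSpace X] [TopologicalSpace 𝔸] {M : MDP X 𝔸}

lemma CondSU.exists_measure_compl_le {K : ℕ → Set X} {F : ℕ → Set 𝔸} (h : M.CondSU K F)
    {L ε : ℝ≥0∞} (hL : L ≠ ⊤) (hε : ε ≠ 0) :
    ∃ m, ∀ γ : Measure (X × 𝔸), IsProbabilityMeasure γ → ∫⁻ z, M.c z ∂γ ≤ L →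
      γ (K m ×ˢ F m)ᶜ ≤ ε := by
  -- At cost level `L / ε + 1` Markov's inequality leaves mass at most `ε`; the `+ 1` keeps the
  -- level nonzero.
  have hR : L / ε + 1 ≠ ⊤ := ENNReal.add_ne_top.2 ⟨ENNReal.div_ne_top hL hε, by simp⟩
  obtain ⟨m, hm⟩ := (Tendsto.eventually_const_lt hR.lt_top h.2.2.2.2).exists
  refine ⟨m, fun γ _ hγ => ?_⟩
  rcases eq_or_ne ε ⊤ with rfl | hε'
  · exact le_top
  have hsub : (K m ×ˢ F m)ᶜ ⊆ {z | L / ε + 1 ≤ M.c z} := by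
    intro z hz
    by_cases hzg : z ∈ M.graph
    · exact hm.le.trans (iInf₂_le z ⟨hzg, hz⟩)
    · simp [M.c_eq_top_of_notMem hzg]
  calc γ (K m ×ˢ F m)ᶜ ≤ γ {z | L / ε + 1 ≤ M.c z} := measure_mono hsub
    _ ≤ (∫⁻ z, M.c z ∂γ) / (L / ε + 1) :=
        meas_ge_le_lintegral_div M.measurable_c.aemeasurable (by simp) hR
    _ ≤ ε := by
        refine ENNReal.div_le_of_le_mul (hγ.trans ?_)
        rw [mul_add, ENNReal.mul_div_cancel hε hε']
        exact le_self_add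

lemma lowerSemicontinuousOn_lintegral_q [OpensMeasurableSpace X] {s : Set (X × 𝔸)} (hq : ContinuousOn M.qProb s)
    (f : BoundedContinuousFunction X NNReal) :
    LowerSemicontinuousOn (fun z => ∫⁻ x, f x ∂(M.q z)) s := by
  refine ContinuousOn.lowerSemicontinuousOn fun z hz => ?_
  exact ProbabilityMeasure.tendsto_iff_forall_lintegral_tendsto.1 (hq z hz) f

variable [BorelSpace X] [DiscreteTopology 𝔸] [BorelSpace 𝔸]

/-- The majorization of the transition kernel passes to approximately stationary laws. -/
lemma exists_majorizedOff [OpensMeasurableSpace (X × 𝔸)] [T2Space X]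
    {γs : ℕ → ProbabilityMeasure (X × 𝔸)} {δ : ℕ → ℝ≥0∞}
    (hγ : ∀ n, M.IsApproxStationary (γs n) (δ n)) (hδ : Tendsto δ atTop (𝓝 0))
    (hgraph : ∀ n, ∀ᵐ z ∂(γs n : Measure (X × 𝔸)), z ∈ M.graph)
    {K O D : Set X} {F : Set 𝔸} {ν : Measure X} [IsFiniteMeasure ν] (hK : IsCompact K)
    (hF : IsCompact F) (hKO : K ⊆ O) (hO : IsOpen O) (hD : IsClosed D)
    (hq : ∀ B, MeasurableSet B → ∀ z ∈ M.graph, M.q z ((O \ D) ∩ B) ≤ ν B) :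
    ∃ ν' δ', MajorizedOff γs (K ×ˢ F) (D ×ˢ Set.univ) ν' δ' := by
  have hFfin : F.Finite := hF.finite_of_discrete
  -- One copy of `ν` on each slice `X × {a}`; the error is incurred once per action in the finite
  -- set `F`.
  refine ⟨∑ a ∈ hFfin.toFinset, ν.map fun x => (x, a), fun n => hFfin.toFinset.card * δ n,
    hK.measurableSet.prod hFfin.measurableSet, hD.prod isClosed_univ, ?_, ?_, ?_⟩
  · infer_instance
  · simpa using ENNReal.Tendsto.const_mul hδ (Or.inr (ENNReal.natCast_ne_top _))
  · intro n B hB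
    have hsec : ∀ a : 𝔸, MeasurableSet {x : X | (x, a) ∈ B} := fun a =>
      measurable_prodMk_right hB
    have hOD : MeasurableSet (O \ D) := hO.measurableSet.diff hD.measurableSet
    have hsub : B ∩ (K ×ˢ F \ D ×ˢ Set.univ)
        ⊆ ⋃ a ∈ hFfin.toFinset, Prod.fst ⁻¹' ((O \ D) ∩ {x | (x, a) ∈ B}) := by
      rintro ⟨x, a⟩ ⟨hzB, ⟨hxK, haF⟩, hxD⟩
      simp only [Set.mem_iUnion]
      exact ⟨a, by simpa using haF, ⟨hKO hxK, fun h => hxD ⟨h, trivial⟩⟩, hzB⟩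
    have hone : ∀ a, (γs n : Measure (X × 𝔸)) (Prod.fst ⁻¹' ((O \ D) ∩ {x | (x, a) ∈ B}))
        ≤ ν.map (fun x => (x, a)) B + δ n := by
      intro a
      rw [← Measure.fst_apply (hOD.inter (hsec a)), Measure.map_apply measurable_prodMk_right hB]
      -- Approximate stationarity trades the state marginal for its image under `q`, to which the
      -- majorization applies.
      refine ((hγ n).fst_le _ (hOD.inter (hsec a))).trans ?_
      refine add_le_add_left ?_ _
      rw [Measure.bind_apply (hOD.inter (hsec a)) M.q.aemeasurable]
      calc ∫⁻ z, M.q z ((O \ D) ∩ {x | (x, a) ∈ B}) ∂(γs n : Measure (X × 𝔸))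
          ≤ ∫⁻ _, ν {x | (x, a) ∈ B} ∂(γs n : Measure (X × 𝔸)) :=
            lintegral_mono_ae ((hgraph n).mono fun z hz => hq _ (hsec a) z hz)
        _ = ν ((fun x => (x, a)) ⁻¹' B) := by simp; rfl
    calc (γs n : Measure (X × 𝔸)) (B ∩ (K ×ˢ F \ D ×ˢ Set.univ))
        ≤ ∑ a ∈ hFfin.toFinset,
            (γs n : Measure (X × 𝔸)) (Prod.fst ⁻¹' ((O \ D) ∩ {x | (x, a) ∈ B})) :=
          (measure_mono hsub).trans (measure_biUnion_finset_le _ _)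
      _ ≤ ∑ a ∈ hFfin.toFinset, (ν.map (fun x => (x, a)) B + δ n) :=
          Finset.sum_le_sum fun a _ => hone a
      _ = _ := by
          rw [Finset.sum_add_distrib, Finset.sum_const, nsmul_eq_mul, Measure.finsetSum_apply]

/-- There is a joint law of state-action pairs that is stationary and optimal. -/
lemma exists_stationary_optimal [TopologicalSpace.MetrizableSpace X] [SecondCountableTopology X]
    [Countable 𝔸] (hM : M.optimalCost < ⊤) {K : ℕ → Set X} {F : ℕ → Set 𝔸} (hSU : M.CondSU K F)
    (hMaj : M.CondM K) :
    ∃ γ : ProbabilityMeasure (X × 𝔸), M.q ∘ₘ (γ : Measure (X × 𝔸)) = (γ : Measure (X × 𝔸)).fst ∧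
      ∫⁻ z, M.c z ∂(γ : Measure (X × 𝔸)) ≤ M.optimalCost := by
  choose γ₀ hstat₀ hcost₀ using M.exists_isApproxStationary hM
  have hbound₀ : ∀ n, ∫⁻ z, M.c z ∂(γ₀ n : Measure (X × 𝔸)) ≤ M.optimalCost + 1 := fun n =>
    (hcost₀ n).trans (by gcongr; simp)
  have hL : M.optimalCost + 1 ≠ ⊤ := ENNReal.add_ne_top.2 ⟨hM.ne, by simp⟩
  have htight : IsTightMeasureSet {(μ : Measure (X × 𝔸)) | μ ∈ Set.range γ₀} := by
    refine isTightMeasureSet_iff_exists_isCompact_measure_compl_le.2 fun ε hε => ?_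
    obtain ⟨m, hm⟩ := hSU.exists_measure_compl_le hL hε.ne'
    refine ⟨K m ×ˢ F m, (hSU.2.2.1 m).prod (hSU.2.2.2.1 m), ?_⟩
    rintro _ ⟨_, ⟨n, rfl⟩, rfl⟩
    exact hm _ inferInstance (hbound₀ n)
  obtain ⟨γ, -, φ, hφ, hlim⟩ := (isCompact_closure_of_isTightMeasureSet htight).tendsto_subseq
    fun n => subset_closure (Set.mem_range_self n)
  set γs : ℕ → ProbabilityMeasure (X × 𝔸) := γ₀ ∘ φ
  set δ : ℕ → ℝ≥0∞ := fun n => ((φ n : ℝ≥0∞) + 1)⁻¹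
  have hδ : Tendsto δ atTop (𝓝 0) := by
    have h1 : Tendsto (fun n : ℕ => ((n + 1 : ℕ) : ℝ≥0∞)⁻¹) atTop (𝓝 0) :=
      ENNReal.tendsto_inv_nat_nhds_zero.comp (tendsto_add_atTop_nat 1)
    exact (h1.comp hφ.tendsto_atTop).congr fun n => by simp [δ]
  have hstat : ∀ n, M.IsApproxStationary (γs n) (δ n) := fun n => hstat₀ (φ n)
  have hbound : ∀ n, ∫⁻ z, M.c z ∂(γs n : Measure (X × 𝔸)) ≤ M.optimalCost + 1 := fun n =>
    hbound₀ (φ n)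
  have hgraph : ∀ n, ∀ᵐ z ∂(γs n : Measure (X × 𝔸)), z ∈ M.graph := fun n =>
    M.ae_mem_graph_of_lintegral_c_ne_top ((hbound n).trans_lt hL.lt_top).ne
  -- Stated for general `g` so as to cover both the cost and `z ↦ ∫ f dq(z)`.
  have hfatou : ∀ g : X × 𝔸 → ℝ≥0∞, Measurable g →
      (∀ D, ContinuousOn M.qProb (D ×ˢ Set.univ) → LowerSemicontinuousOn M.c (D ×ˢ Set.univ) →
        LowerSemicontinuousOn g (D ×ˢ Set.univ)) →
      ∫⁻ z, g z ∂(γ : Measure (X × 𝔸))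
        ≤ liminf (fun n => ∫⁻ z, g z ∂(γs n : Measure (X × 𝔸))) atTop := by
    intro g hg hlsc
    refine lintegral_le_liminf_of_majorizedOff hlim hg fun ε hε => ?_
    obtain ⟨m, hm⟩ := hSU.exists_measure_compl_le hL hε
    obtain ⟨O, D, ν, hO, hKO, hν, hD, hqD, hcD, hqν⟩ := hMaj m
    obtain ⟨ν', δ', hmaj⟩ := exists_majorizedOff hstat hδ hgraph (hSU.2.2.1 m) (hSU.2.2.2.1 m)
      hKO hO hD hqν
    exact ⟨_, _, ν', δ', hmaj, hlsc D hqD hcD, fun n => hm _ inferInstance (hbound n)⟩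
  refine ⟨γ, ?_, ?_⟩
  · refine Measure.eq_of_forall_lintegral_le fun f => ?_
    have hfm : Measurable fun x => (f x : ℝ≥0∞) := f.continuous.measurable.coe_nnreal_ennreal
    have hmapc : Tendsto (fun n => ∫⁻ x, f x ∂(γs n : Measure (X × 𝔸)).fst) atTop
        (𝓝 (∫⁻ x, f x ∂(γ : Measure (X × 𝔸)).fst)) := by
      simp_rw [Measure.fst, lintegral_map hfm measurable_fst]
      exact ProbabilityMeasure.tendsto_iff_forall_lintegral_tendsto.1 hlim
        (f.compContinuous ⟨Prod.fst, continuous_fst⟩)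
    have herr : Tendsto (fun n => ∫⁻ x, f x ∂(γs n : Measure (X × 𝔸)).fst
        + δ n * (nndist f 0 : NNReal)) atTop (𝓝 (∫⁻ x, f x ∂(γ : Measure (X × 𝔸)).fst)) := by
      have := hmapc.add (ENNReal.Tendsto.mul_const (b := (nndist f 0 : NNReal)) hδ
        (Or.inr ENNReal.coe_ne_top))
      rwa [zero_mul, add_zero] at this
    rw [Measure.lintegral_bind M.q.aemeasurable hfm.aemeasurable]
    refine (hfatou _ hfm.lintegral_kernel
      fun D hq _ => lowerSemicontinuousOn_lintegral_q hq f).trans ?_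
    rw [← herr.liminf_eq]
    refine liminf_le_liminf (Eventually.of_forall fun n => ?_)
    have := (hstat n).lintegral_le _ (nndist f 0 : NNReal) hfm fun x => by
      exact_mod_cast BoundedContinuousFunction.NNReal.upper_bound f x
    rwa [Measure.lintegral_bind M.q.aemeasurable hfm.aemeasurable] at this
  · refine (hfatou _ M.measurable_c fun D _ hc => hc).trans ?_
    have hlimc : Tendsto (fun n => M.optimalCost + δ n) atTop (𝓝 M.optimalCost) := by
      simpa using tendsto_const_nhds.add hδ
    rw [← hlimc.liminf_eq]
    exact liminf_le_liminf (Eventually.of_forall fun n => hcost₀ (φ n))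

end Topology

/-- A law of state-action pairs that is carried by the graph disintegrates through a stationary
policy. -/
lemma exists_stationaryPolicy_compProd_eq {M : MDP X 𝔸} [StandardBorelSpace 𝔸] [Nonempty 𝔸]
    (π : M.Policy) (γ : Measure (X × 𝔸)) [IsFiniteMeasure γ] (h : ∀ᵐ z ∂γ, z ∈ M.graph) :
    ∃ μ : M.StationaryPolicy, γ.fst ⊗ₘ μ.kernel = γ := by
  classical
  have hN : MeasurableSet {x | γ.condKernel x (M.A x) = 1} :=
    (Kernel.measurable_kernel_prodMk_left M.measurableSet_graph) (measurableSet_singleton 1)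
  -- Admissibility is required at every state, so on the null set where the disintegration fails it,
  -- the initial kernel of `π` takes over.
  let κ₀ : Kernel X 𝔸 := (π.kernel 0).comap (fun x => (Fin.elim0, x)) (by fun_prop)
  refine ⟨⟨Kernel.piecewise hN γ.condKernel κ₀, inferInstance, fun x => ?_⟩, ?_⟩
  · rw [Kernel.piecewise_apply]
    split_ifs with hx
    · exact hx
    · exact π.admissible 0 _ x
  · conv_rhs => rw [← γ.disintegrate γ.condKernel]
    refine Measure.compProd_congr ?_
    have hae : ∀ᵐ x ∂γ.fst, ∀ᵐ a ∂(γ.condKernel x), (x, a) ∈ M.graph := by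
      refine Measure.ae_ae_of_ae_compProd ?_
      rwa [γ.disintegrate γ.condKernel]
    filter_upwards [hae] with x hx
    rw [Kernel.piecewise_apply, if_pos]
    exact (prob_compl_eq_zero_iff (measurable_prodMk_left M.measurableSet_graph)).1 hx

end MDP

/-! ### Topology of Borel spaces and conclusion -/

lemma IsBorelSubsetOfPolish.metrizableSpace {X : Type u} [TopologicalSpace X]
    (hX : IsBorelSubsetOfPolish X) : TopologicalSpace.MetrizableSpace X := by
  obtain ⟨Y, _, _, e, he, -⟩ := hX
  exact he.metrizableSpace

lemma IsBorelSubsetOfPolish.secondCountableTopology {X : Type u} [TopologicalSpace X]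
    (hX : IsBorelSubsetOfPolish X) : SecondCountableTopology X := by
  obtain ⟨Y, _, _, e, he, -⟩ := hX
  exact he.secondCountableTopology

theorem mainTheorem3 {X : Type u} {𝔸 : Type v}
    [TopologicalSpace X] [MeasurableSpace X] [BorelSpace X] (hX : IsBorelSubsetOfPolish X)
    [TopologicalSpace 𝔸] [DiscreteTopology 𝔸] [Countable 𝔸] [MeasurableSpace 𝔸] [BorelSpace 𝔸]
    (M : MDP X 𝔸) (hG : M.CondG)
    (hSUM : ∃ (K : ℕ → Set X) (F : ℕ → Set 𝔸), M.CondSU K F ∧ M.CondM K) :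
    ∃ (μ : M.StationaryPolicy) (p : ProbabilityMeasure X),
      Kernel.Invariant μ.chain (p : Measure X) ∧ M.IsMinimumPair μ.toPolicy p := by
  have := hX.metrizableSpace
  have := hX.secondCountableTopology
  obtain ⟨K, F, hSU, hMaj⟩ := hSUM
  have hfin := MDP.optimalCost_lt_top hG
  obtain ⟨γ, hinv, hcost⟩ := MDP.exists_stationary_optimal hfin hSU hMaj
  obtain ⟨π, x, -⟩ := hG
  have : Nonempty 𝔸 := (M.A_nonempty x).to_type
  obtain ⟨μ, hμ⟩ := MDP.exists_stationaryPolicy_compProd_eq π γ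
    (M.ae_mem_graph_of_lintegral_c_ne_top (hcost.trans_lt hfin).ne)
  let p : ProbabilityMeasure X := ⟨(γ : Measure (X × 𝔸)).fst, inferInstance⟩
  have hchain : Kernel.Invariant μ.chain (p : Measure X) := by
    change μ.chain ∘ₘ (γ : Measure (X × 𝔸)).fst = (γ : Measure (X × 𝔸)).fst
    rw [← μ.bind_compProd_eq_chain, hμ, hinv]
  refine ⟨μ, p, hchain, le_antisymm ?_ (MDP.optimalCost_le_J μ.toPolicy p)⟩
  rw [μ.J_toPolicy_of_invariant hchain]
  exact (congrArg (fun m => ∫⁻ z, M.c z ∂m) hμ).trans_le hcost
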